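/- Let $K$ be a closed curve in $\mathbb{R}^d$ (a continuous map from the circle), or more generally a link, i.e. a nonempty finite union of closed curves. For a hyperplane $P$, the number of times a closed curve cuts $P$ is counted in the domain circle as follows: it is $2$ if the curve is contained in $P$; it is $\infty$ if the pullback of $P$ to the circle has infinitely many connected components; otherwise, choosing an orientation of the curve and sides "above" and "below" of $P$, it is the number of upward plus the number of downward intersections, where a component of the pullback is an upward intersection if it is preceded by an arc below $P$ or followed by an arc above $P$, and a downward intersection if it is preceded by an arc above $P$ or followed by an arc below $P$ (so a glancing intersection counts twice). For a link, the counts of the component curves are added. The $n$-th hull $h_n(K)$ is the set of points $p\in\mathbb{R}^d$ such that $K$ cuts every hyperplane through $p$ at least $2n$ times. For $p\notin K$, the cone angle at $p$ of the cone from $p$ to $K$ is the length (possibly infinite, and counted with multiplicity) of the radial projection of $K$ to the unit sphere about $p$. **Lemma.** If $p\in h_n(K)$ and $p\notin K$, then the cone from $p$ to $K$ has cone angle at least $2\pi n$; that is, the radial projection of $K$ to the unit sphere about $p$ has length at least $2\pi n$. -/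

import Mathlib

open scoped RealInnerProductSpace

/-- A closed curve in `ℝ^d`: a continuous map from the circle `ℝ / ℤ`. -/
abbrev ClosedCurve (d : ℕ) : Type := C(UnitAddCircle, EuclideanSpace ℝ (Fin d))

namespace ClosedCurve

variable {d : ℕ}

/-- The signed height of the curve above the hyperplane `{x | ⟪u, x⟫ = c}`, as a function on the
domain circle. The curve is above the hyperplane where it is positive, below where negative. -/
noncomputable def height (K : ClosedCurve d) (u : EuclideanSpace ℝ (Fin d)) (c : ℝ)
    (x : UnitAddCircle) : ℝ :=
  ⟪u, K x⟫ - c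

/-- The pullback to the domain circle of the intersection of the curve with the hyperplane
`{x | ⟪u, x⟫ = c}`. -/
def pullback (K : ClosedCurve d) (u : EuclideanSpace ℝ (Fin d)) (c : ℝ) : Set UnitAddCircle :=
  {x | K.height u c x = 0}

/-- The connected components (as subsets of the circle) of that pullback. -/
def components (K : ClosedCurve d) (u : EuclideanSpace ℝ (Fin d)) (c : ℝ) :
    Set (Set UnitAddCircle) :=
  {C | ∃ x ∈ K.pullback u c, C = connectedComponentIn (K.pullback u c) x}

/-- `C` is preceded by an open arc of the curve that lies below the hyperplane. -/
def PrecededBelow (K : ClosedCurve d) (u : EuclideanSpace ℝ (Fin d)) (c : ℝ)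
    (C : Set UnitAddCircle) : Prop :=
  ∃ t : ℝ, (t : UnitAddCircle) ∈ C ∧
    ∃ ε > 0, ∀ s ∈ Set.Ioo (t - ε) t, K.height u c (s : UnitAddCircle) < 0

/-- `C` is preceded by an open arc of the curve that lies above the hyperplane. -/
def PrecededAbove (K : ClosedCurve d) (u : EuclideanSpace ℝ (Fin d)) (c : ℝ)
    (C : Set UnitAddCircle) : Prop :=
  ∃ t : ℝ, (t : UnitAddCircle) ∈ C ∧
    ∃ ε > 0, ∀ s ∈ Set.Ioo (t - ε) t, 0 < K.height u c (s : UnitAddCircle)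

/-- `C` is followed by an open arc of the curve that lies below the hyperplane. -/
def FollowedBelow (K : ClosedCurve d) (u : EuclideanSpace ℝ (Fin d)) (c : ℝ)
    (C : Set UnitAddCircle) : Prop :=
  ∃ t : ℝ, (t : UnitAddCircle) ∈ C ∧
    ∃ ε > 0, ∀ s ∈ Set.Ioo t (t + ε), K.height u c (s : UnitAddCircle) < 0

/-- `C` is followed by an open arc of the curve that lies above the hyperplane. -/
def FollowedAbove (K : ClosedCurve d) (u : EuclideanSpace ℝ (Fin d)) (c : ℝ)
    (C : Set UnitAddCircle) : Prop :=
  ∃ t : ℝ, (t : UnitAddCircle) ∈ C ∧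
    ∃ ε > 0, ∀ s ∈ Set.Ioo t (t + ε), 0 < K.height u c (s : UnitAddCircle)

/-- The upward intersections of the curve with the hyperplane. -/
def upward (K : ClosedCurve d) (u : EuclideanSpace ℝ (Fin d)) (c : ℝ) :
    Set (Set UnitAddCircle) :=
  {C ∈ K.components u c | K.PrecededBelow u c C ∨ K.FollowedAbove u c C}

/-- The downward intersections of the curve with the hyperplane. -/
def downward (K : ClosedCurve d) (u : EuclideanSpace ℝ (Fin d)) (c : ℝ) :
    Set (Set UnitAddCircle) :=
  {C ∈ K.components u c | K.PrecededAbove u c C ∨ K.FollowedBelow u c C}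

open Classical in
/-- The number of times the curve cuts the hyperplane `{x | ⟪u, x⟫ = c}`: two if the curve is
contained in it, infinity if the intersection has infinitely many components, and otherwise the
number of upward intersections plus the number of downward ones (so that a glancing component,
which is both upward and downward, counts twice). -/
noncomputable def cutCount (K : ClosedCurve d) (u : EuclideanSpace ℝ (Fin d)) (c : ℝ) : ℕ∞ :=
  if ∀ x, ⟪u, K x⟫ = c then 2
  else if (K.components u c).Infinite then ⊤
  else (K.upward u c).encard + (K.downward u c).encard

end ClosedCurve

/-- The `n`-th hull of a union of closed curves (a single closed curve is the case where `ι` has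
one element): the points `p` such that every hyperplane through `p` is cut at least `2 * n` times.
The hyperplanes through `p` are the sets `{x | ⟪u, x⟫ = ⟪u, p⟫}` with `u ≠ 0`. -/
def nthHull {d : ℕ} {ι : Type*} [Fintype ι] (K : ι → ClosedCurve d) (n : ℕ) :
    Set (EuclideanSpace ℝ (Fin d)) :=
  {p | ∀ u : EuclideanSpace ℝ (Fin d), u ≠ 0 →
    ((2 * n : ℕ) : ℕ∞) ≤ ∑ i, (K i).cutCount u ⟪u, p⟫}

/-- Radial projection to the unit sphere about `p` (meaningful for `x ≠ p`). -/
noncomputable def radialProjection {d : ℕ} (p x : EuclideanSpace ℝ (Fin d)) :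
    EuclideanSpace ℝ (Fin d) :=
  p + ‖x - p‖⁻¹ • (x - p)

/-- The cone angle at `p` of the cone from `p` to a union of closed curves avoiding `p`: the length
(total variation, possibly infinite) of the radial projection of the curves to the unit sphere
about `p`. -/
noncomputable def coneAngle {d : ℕ} {ι : Type*} [Fintype ι] (K : ι → ClosedCurve d)
    (p : EuclideanSpace ℝ (Fin d)) : ENNReal :=
  ∑ i, eVariationOn (fun t : ℝ => radialProjection p (K i (t : UnitAddCircle))) (Set.Icc 0 1)

/-! Crofton's formula, used as an inequality. Place p at the origin. A random hyperplane through p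
separates two directions at angle θ with probability at most θ/π, so the mean number of crossings
with K is at most the length of the radial projection divided by π
(`lintegral_liminf_gridCount_le`). Almost every hyperplane is crossed at least 2n times, so the
length is at least 2πn. Normals are drawn from the unit ball, whose Lebesgue measure is finite and
invariant under isometries.

The curves are merely continuous, so crossings are counted as sign changes along ever finer uniform
grids, and Fatou's lemma handles the limit. It remains to bound the cut count by the liminf of the
grid counts for almost every normal. Almost every normal is generic: the height vanishes at no
rational parameter and has no zero extremum on a rational interval (`ae_isGenericDirection`). Each
component of the cut is then a single point that counts at most once
(`ClosedCurve.cutCount_le_encard`), and near each such point fine grids see a sign change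
(`IsGenericDirection.encard_zeros_le_liminf`). -/

open MeasureTheory Filter Topology

/-! ### Crofton's inequality for one great-circle arc -/

section Crofton

variable {E : Type*} [NormedAddCommGroup E] [InnerProductSpace ℝ E]

/-- The set of directions `u` whose orthogonal hyperplane strictly separates `v` from `w`. -/
def separating (v w : E) : Set E := {u | ⟪u, v⟫ * ⟪u, w⟫ < 0}

theorem isOpen_separating (v w : E) : IsOpen (separating v w) :=
  isOpen_lt (by fun_prop) continuous_const

theorem separating_comm (v w : E) : separating v w = separating w v := by
  ext u; simp [separating, mul_comm]

theorem norm_inv_norm_smul {v : E} (hv : v ≠ 0) : ‖‖v‖⁻¹ • v‖ = 1 := by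
  rw [norm_smul, norm_inv, norm_norm, inv_mul_cancel₀ (norm_ne_zero_iff.mpr hv)]

theorem separating_smul {a b : ℝ} (ha : 0 < a) (hb : 0 < b) (v w : E) :
    separating (a • v) (b • w) = separating v w := by
  ext u
  have : (a * ⟪u, v⟫) * (b * ⟪u, w⟫) = (a * b) * (⟪u, v⟫ * ⟪u, w⟫) := by ring
  simp only [separating, Set.mem_ofPred_eq, real_inner_smul_right, this]
  have hab := mul_pos ha hb
  constructor
  · intro h
    by_contra hc
    exact absurd h (not_lt.mpr (mul_nonneg hab.le (not_lt.mp hc)))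
  · exact fun h => mul_neg_of_pos_of_neg hab h

/-- The floor numbers the half-periods on which cosine keeps its sign; shifting both arguments by
the same multiple of π changes both signs alike. -/
theorem cos_mul_cos_nonneg_of_floor_eq {x y : ℝ}
    (h : ⌊x / Real.pi + 1 / 2⌋ = ⌊y / Real.pi + 1 / 2⌋) : 0 ≤ Real.cos x * Real.cos y := by
  have key : ∀ z : ℝ, 0 ≤ Real.cos (z - ⌊z / Real.pi + 1 / 2⌋ * Real.pi) := by
    intro z
    have h1 := Int.floor_le (z / Real.pi + 1 / 2)
    have h2 := Int.lt_floor_add_one (z / Real.pi + 1 / 2)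
    have hz : z / Real.pi * Real.pi = z := div_mul_cancel₀ _ Real.pi_ne_zero
    apply Real.cos_nonneg_of_mem_Icc
    constructor <;> nlinarith [Real.pi_pos]
  have hx := key x
  have hy := key y
  rw [← h] at hy
  rw [Real.cos_sub_int_mul_pi] at hx hy
  have := mul_nonneg hx hy
  set n := ⌊x / Real.pi + 1 / 2⌋
  have e : ((-1 : ℝ) ^ n) * ((-1 : ℝ) ^ n) = 1 := by
    rw [← mul_zpow]; simp
  calc (0 : ℝ) ≤ _ := this
    _ = (((-1 : ℝ) ^ n) * ((-1 : ℝ) ^ n)) * (Real.cos x * Real.cos y) := by ring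
    _ = _ := by rw [e, one_mul]

/-- A cosine wave sampled with step `θ` changes sign about once every `π / θ` samples. -/
theorem card_cos_sign_changes_le {θ : ℝ} (hθ : 0 ≤ θ) (φ : ℝ) (k : ℕ) :
    (((Finset.range k).filter fun j : ℕ =>
      Real.cos (j * θ - φ) * Real.cos ((j + 1 : ℕ) * θ - φ) < 0).card : ℝ)
      ≤ k * θ / Real.pi + 1 := by
  -- `F j` is the index of the half-period containing the sample. A sign change forces it to grow,
  -- so the count telescopes to `F k - F 0`; rounding costs the extra 1.
  set F : ℕ → ℤ := fun j => ⌊(j * θ - φ) / Real.pi + 1 / 2⌋ with hF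
  have step : ∀ j : ℕ, (if Real.cos (j * θ - φ) * Real.cos ((j + 1 : ℕ) * θ - φ) < 0
      then (1 : ℤ) else 0) ≤ F (j + 1) - F j := by
    intro j
    have hmono : F j ≤ F (j + 1) := by
      apply Int.floor_le_floor
      have := Real.pi_pos
      push_cast
      gcongr
      linarith
    split_ifs with h
    · by_contra hc
      have : F j = F (j + 1) := by omega
      exact absurd (cos_mul_cos_nonneg_of_floor_eq this) (not_le.mpr h)
    · omega
  have hsum := Finset.sum_le_sum fun j (_ : j ∈ Finset.range k) => step j
  rw [Finset.sum_range_sub, ← Finset.sum_filter, Finset.sum_const, nsmul_one] at hsum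
  have h3 : ((F k - F 0 : ℤ) : ℝ) ≤ k * θ / Real.pi + 1 := by
    have h1 := Int.floor_le ((k * θ - φ) / Real.pi + 1 / 2)
    have h2 := Int.lt_floor_add_one (((0 : ℕ) * θ - φ) / Real.pi + 1 / 2)
    push_cast
    simp only [hF]
    have : (k * θ - φ) / Real.pi = k * θ / Real.pi + (((0 : ℕ) * θ - φ) / Real.pi) := by
      push_cast; ring
    linarith
  refine le_trans ?_ h3
  exact_mod_cast hsum

variable [FiniteDimensional ℝ E] [MeasurableSpace E] [BorelSpace E]

variable (E) in
/-- Lebesgue measure on the unit ball. -/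
noncomputable def ballMeasure : Measure E := volume.restrict (Metric.closedBall 0 1)

instance : IsFiniteMeasure (ballMeasure E) :=
  ⟨by simpa [ballMeasure] using (isCompact_closedBall (0 : E) 1).measure_lt_top⟩

theorem ballMeasure_univ_ne_zero : ballMeasure E Set.univ ≠ 0 := by
  simpa [ballMeasure] using (Metric.measure_closedBall_pos volume (0 : E) one_pos).ne'

theorem ballMeasure_absolutelyContinuous : ballMeasure E ≪ volume :=
  Measure.restrict_le_self.absolutelyContinuous

theorem ballMeasure_separating_map (R : E ≃ₗᵢ[ℝ] E) (v w : E) :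
    ballMeasure E (separating (R v) (R w)) = ballMeasure E (separating v w) := by
  have hm := (R.measurePreserving).restrict_preimage (s := Metric.closedBall (0 : E) 1)
    Metric.isClosed_closedBall.measurableSet
  have hb : (R : E → E) ⁻¹' Metric.closedBall 0 1 = Metric.closedBall 0 1 := by
    ext x; simp
  rw [hb] at hm
  rw [ballMeasure, ← hm.measure_preimage (isOpen_separating _ _).measurableSet.nullMeasurableSet]
  congr 1
  ext u
  simp [separating]

/-- The reflection exchanging `a` and `c` fixes `b`. Iterated along a great circle, this shows that
arcs of equal angle have equal measure. -/
theorem ballMeasure_separating_reflect {a b c : E} (hac : ‖a‖ = ‖c‖) (h : ⟪a, b⟫ = ⟪b, c⟫) :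
    ballMeasure E (separating b c) = ballMeasure E (separating a b) := by
  set R := (ℝ ∙ (a - c))ᗮ.reflection
  have h1 : R a = c := Submodule.reflection_sub hac
  have h2 : R b = b := by
    apply Submodule.reflection_mem_subspace_eq_self
    rw [Submodule.mem_orthogonal_singleton_iff_inner_right, inner_sub_left, h,
      real_inner_comm c b, sub_self]
  rw [← ballMeasure_separating_map R a b, h1, h2, separating_comm]

/-- The points at angle `t` on the unit circle spanned by an orthonormal pair. -/
noncomputable def circlePoint (e f : E) (t : ℝ) : E := Real.cos t • e + Real.sin t • f

omit [FiniteDimensional ℝ E] [MeasurableSpace E] [BorelSpace E] in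
theorem inner_circlePoint {e f : E} (he : ‖e‖ = 1) (hf : ‖f‖ = 1) (hef : ⟪e, f⟫ = 0) (s t : ℝ) :
    ⟪circlePoint e f s, circlePoint e f t⟫ = Real.cos (s - t) := by
  have hfe : ⟪f, e⟫ = 0 := by rw [real_inner_comm, hef]
  simp only [circlePoint, inner_add_left, inner_add_right, real_inner_smul_left,
    real_inner_smul_right, hef, hfe, real_inner_self_eq_norm_sq, he, hf, Real.cos_sub]
  ring

omit [FiniteDimensional ℝ E] [MeasurableSpace E] [BorelSpace E] in
theorem norm_circlePoint {e f : E} (he : ‖e‖ = 1) (hf : ‖f‖ = 1) (hef : ⟪e, f⟫ = 0) (s : ℝ) :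
    ‖circlePoint e f s‖ = 1 := by
  have := inner_circlePoint he hf hef s s
  rw [real_inner_self_eq_norm_sq, sub_self, Real.cos_zero] at this
  exact (pow_eq_one_iff_of_nonneg (norm_nonneg _) two_ne_zero).mp this

theorem ballMeasure_separating_circlePoint {e f : E} (he : ‖e‖ = 1) (hf : ‖f‖ = 1)
    (hef : ⟪e, f⟫ = 0) (θ : ℝ) (j : ℕ) :
    ballMeasure E (separating (circlePoint e f (j * θ)) (circlePoint e f ((j + 1 : ℕ) * θ)))
      = ballMeasure E (separating (circlePoint e f 0) (circlePoint e f θ)) := by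
  induction j with
  | zero => simp
  | succ j ih =>
    rw [← ih]
    apply ballMeasure_separating_reflect
    · simp only [norm_circlePoint he hf hef]
    · simp only [inner_circlePoint he hf hef]
      congr 1
      push_cast
      ring

omit [FiniteDimensional ℝ E] [MeasurableSpace E] [BorelSpace E] in
theorem inner_circlePoint_eq (e f u : E) :
    ∃ r φ : ℝ, ∀ t, ⟪u, circlePoint e f t⟫ = r * Real.cos (t - φ) := by
  set z : ℂ := ⟨⟪u, e⟫, ⟪u, f⟫⟩
  refine ⟨‖z‖, z.arg, fun t => ?_⟩
  have h1 : ‖z‖ * Real.cos z.arg = ⟪u, e⟫ := Complex.norm_mul_cos_arg z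
  have h2 : ‖z‖ * Real.sin z.arg = ⟪u, f⟫ := Complex.norm_mul_sin_arg z
  rw [circlePoint, inner_add_right, real_inner_smul_right, real_inner_smul_right, ← h1, ← h2,
    Real.cos_sub]
  ring

/-- Lay `k` arcs of angle θ end to end. Each normal sees a sampled cosine along them, so it
separates the ends of at most kθ/π + 1 arcs. Integrating, dividing by `k` and letting `k` grow
removes the extra 1. -/
theorem ballMeasure_separating_circlePoint_le {e f : E} (he : ‖e‖ = 1) (hf : ‖f‖ = 1)
    (hef : ⟪e, f⟫ = 0) {θ : ℝ} (hθ : 0 ≤ θ) :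
    (ballMeasure E).real (separating (circlePoint e f 0) (circlePoint e f θ))
      ≤ θ / Real.pi * (ballMeasure E).real Set.univ := by
  set M := (ballMeasure E).real Set.univ with hM
  set g := (ballMeasure E).real (separating (circlePoint e f 0) (circlePoint e f θ)) with hg
  have bound : ∀ k : ℕ, k * g ≤ (k * θ / Real.pi + 1) * M := by
    intro k
    set S : ℕ → Set E := fun j =>
      separating (circlePoint e f (j * θ)) (circlePoint e f ((j + 1 : ℕ) * θ)) with hS
    have hSm : ∀ j, MeasurableSet (S j) := fun j => (isOpen_separating _ _).measurableSet
    have h1 : ∫ u, ∑ j ∈ Finset.range k, (S j).indicator (fun _ => (1 : ℝ)) u ∂(ballMeasure E)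
        = k * g := by
      rw [integral_finsetSum _ fun j _ => (integrable_const (1 : ℝ)).indicator (hSm j)]
      have : ∀ j, ∫ u, (S j).indicator (fun _ => (1 : ℝ)) u ∂(ballMeasure E) = g := by
        intro j
        rw [integral_indicator_const _ (hSm j), smul_eq_mul, mul_one, hg, measureReal_def,
          measureReal_def, hS, ballMeasure_separating_circlePoint he hf hef]
      simp [this]
    have h2 : ∫ u, ∑ j ∈ Finset.range k, (S j).indicator (fun _ => (1 : ℝ)) u ∂(ballMeasure E)
        ≤ ∫ _, (k * θ / Real.pi + 1) ∂(ballMeasure E) := by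
      apply integral_mono
      · exact integrable_finsetSum _ fun j _ => (integrable_const (1 : ℝ)).indicator (hSm j)
      · exact integrable_const _
      · intro u
        obtain ⟨r, φ, hr⟩ := inner_circlePoint_eq e f u
        refine le_trans ?_ (card_cos_sign_changes_le hθ φ k)
        rw [Finset.card_filter]
        push_cast
        apply Finset.sum_le_sum
        intro j _
        by_cases hu : u ∈ S j
        · have hu' := hu
          simp only [hS, separating, Set.mem_ofPred_eq, hr] at hu'
          have hneg : Real.cos (j * θ - φ) * Real.cos ((j + 1 : ℕ) * θ - φ) < 0 := by
            by_contra hc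
            push Not at hc
            nlinarith [mul_nonneg (mul_self_nonneg r) hc]
          push_cast at hneg
          simp [hu, hneg]
        · simp only [Set.indicator_of_notMem hu]
          split_ifs <;> simp
    rw [h1, integral_const, smul_eq_mul, mul_comm] at h2
    linarith
  have hlim : Tendsto (fun k : ℕ => θ / Real.pi * M + M * (1 / ((k : ℝ) + 1))) atTop
      (𝓝 (θ / Real.pi * M + M * 0)) :=
    (tendsto_one_div_add_atTop_nhds_zero_nat.const_mul M).const_add _
  rw [mul_zero, add_zero] at hlim
  refine ge_of_tendsto hlim (Eventually.of_forall fun k => ?_)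
  have hk : (0 : ℝ) < k + 1 := by positivity
  have hb := bound (k + 1)
  push_cast at hb
  have : g ≤ ((k + 1) * θ / Real.pi + 1) * M / (k + 1) := by
    rw [le_div_iff₀ hk]; linarith
  refine this.trans_eq ?_
  have := Real.pi_ne_zero
  field_simp

omit [FiniteDimensional ℝ E] [MeasurableSpace E] [BorelSpace E] in
theorem exists_circlePoint_eq {v w : E} (hv : ‖v‖ = 1) (hw : ‖w‖ = 1) (h1 : ⟪v, w⟫ ≠ 1)
    (h2 : ⟪v, w⟫ ≠ -1) :
    ∃ f : E, ‖f‖ = 1 ∧ ⟪v, f⟫ = 0 ∧ circlePoint v f (InnerProductGeometry.angle v w) = w := by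
  set θ := InnerProductGeometry.angle v w
  have hc : Real.cos θ = ⟪v, w⟫ := by simp [θ, InnerProductGeometry.cos_angle, hv, hw]
  have hs0 : 0 ≤ Real.sin θ := InnerProductGeometry.sin_angle_nonneg v w
  have hsq := Real.sin_sq_add_cos_sq θ
  have hs : Real.sin θ ≠ 0 := by
    intro h0
    rw [h0, hc] at hsq
    have : (⟪v, w⟫ - 1) * (⟪v, w⟫ + 1) = 0 := by linarith
    rcases mul_eq_zero.mp this with h | h
    · exact h1 (by linarith)
    · exact h2 (by linarith)
  have hvv : ⟪v, v⟫ = 1 := by rw [real_inner_self_eq_norm_sq, hv]; norm_num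
  have hww : ⟪w, w⟫ = 1 := by rw [real_inner_self_eq_norm_sq, hw]; norm_num
  refine ⟨(Real.sin θ)⁻¹ • (w - Real.cos θ • v), ?_, ?_, ?_⟩
  · have hn : ‖w - Real.cos θ • v‖ ^ 2 = Real.sin θ ^ 2 := by
      rw [← real_inner_self_eq_norm_sq]
      simp only [inner_sub_left, inner_sub_right, real_inner_smul_left, real_inner_smul_right,
        hvv, hww, real_inner_comm v w, hc] at *
      nlinarith
    have hn' : ‖w - Real.cos θ • v‖ = Real.sin θ := by
      rwa [sq_eq_sq₀ (norm_nonneg _) hs0] at hn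
    rw [norm_smul, hn', norm_inv, Real.norm_of_nonneg hs0, inv_mul_cancel₀ hs]
  · rw [real_inner_smul_right, inner_sub_right, real_inner_smul_right, hvv, hc, mul_one, sub_self,
      mul_zero]
  · rw [circlePoint, smul_smul, mul_inv_cancel₀ hs, one_smul, add_sub_cancel]

theorem ballMeasure_separating_le_of_norm_one {v w : E} (hv : ‖v‖ = 1) (hw : ‖w‖ = 1) :
    (ballMeasure E).real (separating v w)
      ≤ InnerProductGeometry.angle v w / Real.pi * (ballMeasure E).real Set.univ := by
  by_cases h1 : ⟪v, w⟫ = 1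
  · have : v = w := (inner_eq_one_iff_of_norm_eq_one hv hw).mp h1
    subst this
    have h0 : separating v v = ∅ := by
      ext u; simp [separating, mul_self_nonneg]
    rw [h0, measureReal_empty]
    have := InnerProductGeometry.angle_nonneg v v
    have := Real.pi_pos
    positivity
  by_cases h2 : ⟪v, w⟫ = -1
  · have : InnerProductGeometry.angle v w = Real.pi := by
      simp [InnerProductGeometry.angle, hv, hw, h2]
    rw [this, div_self Real.pi_ne_zero, one_mul]
    exact measureReal_mono (Set.subset_univ _)
  obtain ⟨f, hf, hvf, h⟩ := exists_circlePoint_eq hv hw h1 h2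
  have := ballMeasure_separating_circlePoint_le hv hf hvf (InnerProductGeometry.angle_nonneg v w)
  rw [h] at this
  simpa [circlePoint] using this

/-- Crofton's formula for a great-circle arc, as an upper bound. -/
theorem ballMeasure_separating_le {v w : E} (hv : v ≠ 0) (hw : w ≠ 0) :
    (ballMeasure E).real (separating v w)
      ≤ InnerProductGeometry.angle v w / Real.pi * (ballMeasure E).real Set.univ := by
  have hv' : 0 < ‖v‖⁻¹ := by positivity
  have hw' : 0 < ‖w‖⁻¹ := by positivity
  have := ballMeasure_separating_le_of_norm_one (v := ‖v‖⁻¹ • v) (w := ‖w‖⁻¹ • w)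
    (norm_inv_norm_smul hv) (norm_inv_norm_smul hw)
  rwa [separating_smul hv' hw', InnerProductGeometry.angle_smul_left_of_pos _ _ hv',
    InnerProductGeometry.angle_smul_right_of_pos _ _ hw'] at this

omit [FiniteDimensional ℝ E] [MeasurableSpace E] [BorelSpace E] in
theorem dist_normalize_eq_two_mul_sin {v w : E} (hv : v ≠ 0) (hw : w ≠ 0) :
    dist (‖v‖⁻¹ • v) (‖w‖⁻¹ • w) = 2 * Real.sin (InnerProductGeometry.angle v w / 2) := by
  have hv' : ‖v‖ ≠ 0 := norm_ne_zero_iff.mpr hv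
  have hw' : ‖w‖ ≠ 0 := norm_ne_zero_iff.mpr hw
  set θ := InnerProductGeometry.angle v w with hθ
  have hs : 0 ≤ Real.sin (θ / 2) := Real.sin_nonneg_of_nonneg_of_le_pi
    (by linarith [InnerProductGeometry.angle_nonneg v w])
    (by linarith [InnerProductGeometry.angle_le_pi v w, Real.pi_pos])
  have hi : ⟪v, w⟫ = ‖v‖ * ‖w‖ * Real.cos θ := by
    rw [hθ, InnerProductGeometry.cos_angle]; field_simp
  rw [← sq_eq_sq₀ dist_nonneg (by positivity), dist_eq_norm, norm_sub_sq_real,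
    norm_inv_norm_smul hv, norm_inv_norm_smul hw, real_inner_smul_left, real_inner_smul_right, hi]
  have : Real.cos θ = 1 - 2 * Real.sin (θ / 2) ^ 2 := by
    have h := Real.cos_sq_add_sin_sq (θ / 2)
    have h2 := Real.cos_two_mul (θ / 2)
    rw [mul_div_cancel₀ _ two_ne_zero] at h2
    linarith
  rw [this]
  field_simp
  ring

omit [FiniteDimensional ℝ E] [MeasurableSpace E] [BorelSpace E] in
/-- Angles are asymptotically equal to chords. -/
theorem exists_forall_mul_angle_le_dist {ε : ℝ} (hε : 0 < ε) :
    ∃ δ > 0, ∀ v w : E, v ≠ 0 → w ≠ 0 → dist (‖v‖⁻¹ • v) (‖w‖⁻¹ • w) < δ →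
      (1 - ε) * InnerProductGeometry.angle v w ≤ dist (‖v‖⁻¹ • v) (‖w‖⁻¹ • w) := by
  -- Jordan's inequality bounds the chord below by 2θ/π, so this δ forces θ < min ε 1; the cubic
  -- error in the sine estimate is then at most a multiple εθ.
  refine ⟨min ε 1 / Real.pi, by have := Real.pi_pos; positivity, fun v w hv hw h => ?_⟩
  rw [dist_normalize_eq_two_mul_sin hv hw] at h ⊢
  have h0 := InnerProductGeometry.angle_nonneg v w
  have hpi := InnerProductGeometry.angle_le_pi v w
  set θ := InnerProductGeometry.angle v w
  rcases h0.eq_or_lt with h0 | h0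
  · simp [← h0]
  have h1 : 2 / Real.pi * (θ / 2) ≤ Real.sin (θ / 2) := Real.mul_le_sin (by linarith) (by linarith)
  have h2 : θ / 2 - (θ / 2) ^ 3 / 6 < Real.sin (θ / 2) := Real.sin_gt_sub_cube (by linarith)
  have hp := Real.pi_pos
  have h3 : θ < min ε 1 := by
    have : 2 * (2 / Real.pi * (θ / 2)) < min ε 1 / Real.pi := by linarith
    rw [lt_div_iff₀ hp] at this
    have e : 2 * (2 / Real.pi * (θ / 2)) * Real.pi = 2 * θ := by field_simp
    linarith
  have h4 : θ < ε := h3.trans_le (min_le_left _ _)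
  have h5 : θ < 1 := h3.trans_le (min_le_right _ _)
  have h6 : θ * θ * θ ≤ ε * θ := by nlinarith [mul_pos h0 h0]
  nlinarith

end Crofton

/-! ### Counting zeros by sign changes on grids -/

section Grid

variable {E : Type*} [NormedAddCommGroup E] [InnerProductSpace ℝ E]

open Classical in
/-- The number of steps of the uniform grid of `[0, 1]` with `m + 1` steps across which the curve
`g` changes sides of the hyperplane orthogonal to `u`. -/
noncomputable def gridCount (g : ℝ → E) (m : ℕ) (u : E) : ℕ :=
  ((Finset.range (m + 1)).filter fun j : ℕ =>
    u ∈ separating (g (j / (m + 1))) (g ((j + 1 : ℕ) / (m + 1)))).card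

theorem gridCount_eq_sum_indicator (g : ℝ → E) (m : ℕ) (u : E) :
    (gridCount g m u : ENNReal) = ∑ j ∈ Finset.range (m + 1),
      (separating (g (j / (m + 1))) (g ((j + 1 : ℕ) / (m + 1)))).indicator 1 u := by
  classical
  simp only [gridCount, Finset.card_filter, Set.indicator_apply, Nat.cast_sum, Pi.one_apply]
  refine Finset.sum_congr rfl fun j _ => ?_
  split_ifs <;> simp

/-- The direction `u` is generic for `g` if `⟪u, g t⟫` vanishes at no rational `t`, and its minimum
and maximum on an interval with rational ends are never zero. -/
structure IsGenericDirection (g : ℝ → E) (u : E) : Prop where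
  ne_zero : ∀ q : ℚ, ⟪u, g q⟫ ≠ 0
  exists_neg : ∀ a b : ℚ, ∀ t ∈ Set.Icc (a : ℝ) b, ⟪u, g t⟫ = 0 →
    ∃ s ∈ Set.Icc (a : ℝ) b, ⟪u, g s⟫ < 0
  exists_pos : ∀ a b : ℚ, ∀ t ∈ Set.Icc (a : ℝ) b, ⟪u, g t⟫ = 0 →
    ∃ s ∈ Set.Icc (a : ℝ) b, 0 < ⟪u, g s⟫

theorem exists_sign_change {x : ℕ → ℝ} (hx : ∀ j, x j ≠ 0) {i k : ℕ} (hi : x i < 0)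
    (hk : 0 < x k) : ∃ j, min i k ≤ j ∧ j < max i k ∧ x j * x (j + 1) < 0 := by
  by_contra! hc
  have same : ∀ j, min i k ≤ j → j ≤ max i k → 0 < x (min i k) * x j := by
    intro j hj
    induction j, hj using Nat.le_induction with
    | base => exact fun _ => mul_self_pos.mpr (hx _)
    | succ j hj ih =>
      intro hj'
      have h1 := ih (by omega)
      have h2 : 0 < x j * x (j + 1) :=
        lt_of_le_of_ne (hc j hj (by omega)) (mul_ne_zero (hx _) (hx _)).symm
      have h3 : 0 < (x (min i k) * x (j + 1)) * (x j * x j) := by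
        have := mul_pos h1 h2
        linarith
      exact pos_of_mul_pos_left h3 (mul_self_nonneg _)
  have := same (max i k) (by omega) le_rfl
  rcases le_total i k with h | h
  · rw [min_eq_left h, max_eq_right h] at this
    nlinarith
  · rw [min_eq_right h, max_eq_left h] at this
    nlinarith

theorem eventually_exists_grid_mem {V : Set ℝ} (hV : IsOpen V) {s : ℝ} (hs : s ∈ V)
    (hs0 : 0 < s) : ∀ᶠ m : ℕ in atTop, ∃ j : ℕ, (j : ℝ) / (m + 1) ∈ V := by
  have hlim : Tendsto (fun m : ℕ => (⌊s * ((m : ℝ) + 1)⌋₊ : ℝ) / (m + 1)) atTop (𝓝 s) := by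
    have h1 : Tendsto (fun m : ℕ => (m : ℝ) + 1) atTop atTop :=
      tendsto_atTop_add_const_right _ _ tendsto_natCast_atTop_atTop
    exact (tendsto_nat_floor_mul_div_atTop hs0.le).comp h1
  filter_upwards [hlim (hV.mem_nhds hs)] with m hm
  exact ⟨_, hm⟩

/-- Genericity gives heights of both signs arbitrarily near the zero. A fine grid samples both, at
rational parameters where the height is nonzero, so some step between them changes sign. -/
theorem IsGenericDirection.eventually_exists_separating {g : ℝ → E} (hg : Continuous g) {u : E}
    (hu : IsGenericDirection g u) {t : ℝ} (ht : t ∈ Set.Ioo (0 : ℝ) 1) (h0 : ⟪u, g t⟫ = 0)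
    {U : Set ℝ} (hU : IsOpen U) (htU : t ∈ U) :
    ∀ᶠ m : ℕ in atTop, ∃ j : ℕ, j < m + 1 ∧ (j : ℝ) / (m + 1) ∈ U ∧
      u ∈ separating (g (j / (m + 1))) (g ((j + 1 : ℕ) / (m + 1))) := by
  have hh : Continuous fun s => ⟪u, g s⟫ := by fun_prop
  obtain ⟨a', b', ⟨ha't, htb'⟩, hab'⟩ :=
    mem_nhds_iff_exists_Ioo_subset.mp ((hU.inter isOpen_Ioo).mem_nhds ⟨htU, ht⟩)
  obtain ⟨a, ha'a, hat⟩ := exists_rat_btwn ha't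
  obtain ⟨b, htb, hbb'⟩ := exists_rat_btwn htb'
  obtain ⟨s₁, hs₁, hneg⟩ := hu.exists_neg a b t ⟨hat.le, htb.le⟩ h0
  obtain ⟨s₂, hs₂, hpos⟩ := hu.exists_pos a b t ⟨hat.le, htb.le⟩ h0
  have hs₁' : s₁ ∈ Set.Ioo a' b' := ⟨ha'a.trans_le hs₁.1, hs₁.2.trans_lt hbb'⟩
  have hs₂' : s₂ ∈ Set.Ioo a' b' := ⟨ha'a.trans_le hs₂.1, hs₂.2.trans_lt hbb'⟩
  filter_upwards [eventually_exists_grid_mem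
    (isOpen_Ioo.inter (isOpen_lt hh continuous_const)) ⟨hs₁', hneg⟩ (hab' hs₁').2.1,
    eventually_exists_grid_mem
    (isOpen_Ioo.inter (isOpen_lt continuous_const hh)) ⟨hs₂', hpos⟩ (hab' hs₂').2.1]
    with m ⟨i, hi, hineg⟩ ⟨k, hk, hkpos⟩
  have hm : (0 : ℝ) < m + 1 := by positivity
  obtain ⟨j, hj1, hj2, hj⟩ := exists_sign_change (x := fun j : ℕ => ⟪u, g (j / (m + 1))⟫)
    (fun j => by simpa using hu.ne_zero ((j : ℚ) / (m + 1))) hineg hkpos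
  have hjU : (j : ℝ) / (m + 1) ∈ Set.Ioo a' b' := by
    constructor
    · refine lt_of_lt_of_le ?_ (div_le_div_of_nonneg_right (Nat.cast_le.mpr hj1) hm.le)
      rcases min_choice i k with h | h <;> rw [h]
      · exact hi.1
      · exact hk.1
    · refine lt_of_le_of_lt (div_le_div_of_nonneg_right (Nat.cast_le.mpr hj2.le) hm.le) ?_
      rcases max_choice i k with h | h <;> rw [h]
      · exact hi.2
      · exact hk.2
  refine ⟨j, ?_, (hab' hjU).1, hj⟩
  have := (hab' hjU).2.2
  rw [div_lt_one hm] at this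
  exact_mod_cast this

theorem IsGenericDirection.eventually_card_le {g : ℝ → E} (hg : Continuous g) {u : E}
    (hu : IsGenericDirection g u) (Z : Finset ℝ)
    (hZ : ∀ t ∈ Z, t ∈ Set.Ioo (0 : ℝ) 1 ∧ ⟪u, g t⟫ = 0) :
    ∀ᶠ m : ℕ in atTop, Z.card ≤ gridCount g m u := by
  classical
  -- Disjoint neighbourhoods make the steps found for different zeros distinct.
  obtain ⟨U, hU, hdisj⟩ := Z.finite_toSet.t2_separation
  have key : ∀ᶠ m : ℕ in atTop, ∀ t ∈ Z, ∃ j : ℕ, j < m + 1 ∧ (j : ℝ) / (m + 1) ∈ U t ∧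
      u ∈ separating (g (j / (m + 1))) (g ((j + 1 : ℕ) / (m + 1))) := by
    rw [Filter.eventually_all_finset]
    exact fun t ht => hu.eventually_exists_separating hg (hZ t ht).1 (hZ t ht).2 (hU t).2 (hU t).1
  filter_upwards [key] with m hm
  choose! j hj1 hj2 hj3 using hm
  refine Finset.card_le_card_of_injOn j (fun t ht => ?_) (fun t ht s hs hts => ?_)
  · exact Finset.mem_coe.mpr (Finset.mem_filter.mpr ⟨Finset.mem_range.mpr (hj1 t ht), hj3 t ht⟩)
  · by_contra hne
    have h2 := hj2 s hs
    rw [← hts] at h2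
    exact Set.disjoint_left.mp (hdisj ht hs hne) (hj2 t ht) h2

theorem IsGenericDirection.encard_zeros_le_liminf {g : ℝ → E} (hg : Continuous g) {u : E}
    (hu : IsGenericDirection g u) :
    ({t ∈ Set.Ioo (0 : ℝ) 1 | ⟪u, g t⟫ = 0}.encard : ENNReal)
      ≤ liminf (fun m => (gridCount g m u : ENNReal)) atTop := by
  set S := {t ∈ Set.Ioo (0 : ℝ) 1 | ⟪u, g t⟫ = 0}
  have key : ∀ Z : Finset ℝ, (Z : Set ℝ) ⊆ S →
      (Z.card : ENNReal) ≤ liminf (fun m => (gridCount g m u : ENNReal)) atTop := fun Z hZ =>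
    le_liminf_of_le (by isBoundedDefault)
      ((hu.eventually_card_le hg Z fun t ht => hZ ht).mono fun m hm => by exact_mod_cast hm)
  by_cases hS : S.Finite
  · have := key hS.toFinset (by simp)
    rw [hS.encard_eq_coe_toFinset_card]
    simpa using this
  · have htop : liminf (fun m => (gridCount g m u : ENNReal)) atTop = ⊤ := by
      refine ENNReal.eq_top_of_forall_nnreal_le fun r => ?_
      obtain ⟨k, hk⟩ := exists_nat_ge r
      obtain ⟨Z, hZ, rfl⟩ := Set.Infinite.exists_subset_card_eq hS k
      refine le_trans ?_ (key Z hZ)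
      exact_mod_cast hk
    rw [htop]
    exact le_top

/-! ### Genericity of almost every direction, and the mean crossing count -/

section Measure

variable [FiniteDimensional ℝ E] [MeasurableSpace E] [BorelSpace E]

theorem ae_inner_ne_zero {v : E} (hv : v ≠ 0) : ∀ᵐ u : E, ⟪u, v⟫ ≠ 0 := by
  have h := Measure.addHaar_submodule (volume : Measure E) (ℝ ∙ v)ᗮ (fun htop => hv (by
    have : v ∈ (ℝ ∙ v)ᗮ := htop ▸ Submodule.mem_top
    rwa [Submodule.mem_orthogonal_singleton_iff_inner_right, inner_self_eq_zero] at this))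
  rw [ae_iff]
  convert h using 2
  ext u
  simp [Submodule.mem_orthogonal_singleton_iff_inner_left]

/-- For almost every `u`, the minimum over `A` of the height in direction `u` is not zero. -/
theorem ae_exists_inner_neg {α : Type*} {g : α → E} (A : Set α) (hg : ∀ t ∈ A, g t ≠ 0) :
    ∀ᵐ u : E, ∀ t ∈ A, ⟪u, g t⟫ = 0 → ∃ s ∈ A, ⟪u, g s⟫ < 0 := by
  -- A point of this convex set with height zero at `t` is on its frontier, since moving it along
  -- `-g t` leaves the set. Frontiers of convex sets are null, however large `A` is.
  set C : Set E := {u | ∀ s ∈ A, 0 ≤ ⟪u, g s⟫}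
  have hC : Convex ℝ C := by
    intro u hu v hv a b ha hb _ s hs
    rw [inner_add_left, real_inner_smul_left, real_inner_smul_left]
    exact add_nonneg (mul_nonneg ha (hu s hs)) (mul_nonneg hb (hv s hs))
  have hnull : ∀ᵐ u : E, u ∉ frontier C :=
    measure_eq_zero_iff_ae_notMem.mp (hC.addHaar_frontier volume)
  filter_upwards [hnull] with u hu t ht h0
  by_contra! hc
  refine hu ⟨subset_closure hc, fun hint => ?_⟩
  have hlim : Tendsto (fun ε : ℝ => u - ε • g t) (𝓝[>] 0) (𝓝 u) := by
    have : Continuous fun ε : ℝ => u - ε • g t := by fun_prop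
    simpa using (this.tendsto 0).mono_left nhdsWithin_le_nhds
  obtain ⟨ε, hε, hεpos⟩ :=
    ((hlim.eventually (mem_interior_iff_mem_nhds.mp hint)).and self_mem_nhdsWithin).exists
  have h1 : 0 ≤ ⟪u - ε • g t, g t⟫ := hε t ht
  rw [inner_sub_left, real_inner_smul_left, h0, real_inner_self_eq_norm_sq] at h1
  have : 0 < ε * ‖g t‖ ^ 2 := mul_pos hεpos (pow_pos (norm_pos_iff.mpr (hg t ht)) 2)
  linarith

theorem ae_isGenericDirection {g : ℝ → E} (hg : ∀ t, g t ≠ 0) :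
    ∀ᵐ u : E, IsGenericDirection g u := by
  have h1 : ∀ᵐ u : E, ∀ q : ℚ, ⟪u, g q⟫ ≠ 0 := ae_all_iff.mpr fun q => ae_inner_ne_zero (hg q)
  have h2 : ∀ᵐ u : E, ∀ a b : ℚ, ∀ t ∈ Set.Icc (a : ℝ) b, ⟪u, g t⟫ = 0 →
      ∃ s ∈ Set.Icc (a : ℝ) b, ⟪u, g s⟫ < 0 :=
    ae_all_iff.mpr fun a => ae_all_iff.mpr fun b => ae_exists_inner_neg _ fun t _ => hg t
  have h3 : ∀ᵐ u : E, ∀ a b : ℚ, ∀ t ∈ Set.Icc (a : ℝ) b, ⟪u, -g t⟫ = 0 →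
      ∃ s ∈ Set.Icc (a : ℝ) b, ⟪u, -g s⟫ < 0 :=
    ae_all_iff.mpr fun a => ae_all_iff.mpr fun b =>
      ae_exists_inner_neg (g := fun t => -g t) _ fun t _ => neg_ne_zero.mpr (hg t)
  filter_upwards [h1, h2, h3] with u h1 h2 h3
  exact ⟨h1, h2, by simpa using h3⟩

omit [FiniteDimensional ℝ E] in
theorem measurable_gridCount (g : ℝ → E) (m : ℕ) :
    Measurable fun u => (gridCount g m u : ENNReal) := by
  simp only [gridCount_eq_sum_indicator]
  exact Finset.measurable_fun_sum _ fun j _ =>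
    measurable_one.indicator (isOpen_separating _ _).measurableSet

omit [FiniteDimensional ℝ E] in
theorem lintegral_gridCount (g : ℝ → E) (m : ℕ) (μ : Measure E) :
    ∫⁻ u, (gridCount g m u : ENNReal) ∂μ = ∑ j ∈ Finset.range (m + 1),
      μ (separating (g (j / (m + 1))) (g ((j + 1 : ℕ) / (m + 1)))) := by
  simp only [gridCount_eq_sum_indicator]
  rw [lintegral_finsetSum _ fun j _ =>
    measurable_one.indicator (isOpen_separating _ _).measurableSet]
  exact Finset.sum_congr rfl fun j _ =>
    lintegral_indicator_one (isOpen_separating _ _).measurableSet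

theorem eventually_lintegral_gridCount_le {g : ℝ → E} (hg : Continuous g) (hg0 : ∀ t, g t ≠ 0)
    {c : ℝ} (hc : 1 < c) :
    ∀ᶠ m : ℕ in atTop, ∫⁻ u, (gridCount g m u : ENNReal) ∂(ballMeasure E)
      ≤ ENNReal.ofReal c * (ENNReal.ofReal Real.pi⁻¹ * ballMeasure E Set.univ *
        eVariationOn (fun t => ‖g t‖⁻¹ • g t) (Set.Icc 0 1)) := by
  have hc0 : 0 < c := by linarith
  have hpi := Real.pi_pos
  -- With ε = 1 - c⁻¹ the angle is at most `c` times the chord, once uniform continuity makes every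
  -- grid chord shorter than δ.
  have hε : 0 < 1 - c⁻¹ := by
    have := inv_lt_one_of_one_lt₀ hc
    linarith
  obtain ⟨δ, hδ, hδ'⟩ := exists_forall_mul_angle_le_dist (E := E) hε
  have hcont : Continuous fun t => ‖g t‖⁻¹ • g t :=
    (hg.norm.inv₀ fun t => norm_ne_zero_iff.mpr (hg0 t)).smul hg
  obtain ⟨η, hη, hη'⟩ := Metric.uniformContinuousOn_iff.mp
    (isCompact_Icc.uniformContinuousOn_of_continuous (s := Set.Icc (0 : ℝ) 1) hcont.continuousOn)
    δ hδ
  have hsmall : ∀ᶠ m : ℕ in atTop, (1 : ℝ) / (m + 1) < η :=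
    tendsto_one_div_add_atTop_nhds_zero_nat.eventually (gt_mem_nhds hη)
  filter_upwards [hsmall] with m hm
  have hm0 : (0 : ℝ) < m + 1 := by positivity
  have hgrid : ∀ j : ℕ, j ≤ m + 1 → (j : ℝ) / (m + 1) ∈ Set.Icc (0 : ℝ) 1 := fun j hj =>
    ⟨by positivity, by rw [div_le_one hm0]; exact_mod_cast hj⟩
  rw [lintegral_gridCount]
  have step : ∀ j ∈ Finset.range (m + 1),
      ballMeasure E (separating (g (j / (m + 1))) (g ((j + 1 : ℕ) / (m + 1))))
      ≤ ENNReal.ofReal c * (ENNReal.ofReal Real.pi⁻¹ * ballMeasure E Set.univ) *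
        edist (‖g ((j + 1 : ℕ) / (m + 1))‖⁻¹ • g ((j + 1 : ℕ) / (m + 1)))
          (‖g (j / (m + 1))‖⁻¹ • g (j / (m + 1))) := by
    intro j hj
    have hj := Finset.mem_range.mp hj
    set v := g (j / (m + 1))
    set w := g ((j + 1 : ℕ) / (m + 1))
    have hd : dist (‖v‖⁻¹ • v) (‖w‖⁻¹ • w) < δ := by
      apply hη' _ (hgrid j (by omega)) _ (hgrid (j + 1) (by omega))
      rw [dist_comm, Real.dist_eq, ← sub_div]
      push_cast
      rwa [add_sub_cancel_left, abs_of_pos (by positivity)]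
    have hang := hδ' v w (hg0 _) (hg0 _) hd
    rw [sub_sub_cancel, inv_mul_le_iff₀ hc0] at hang
    have hb := ballMeasure_separating_le (hg0 (j / (m + 1))) (hg0 ((j + 1 : ℕ) / (m + 1)))
    have hb' : (ballMeasure E).real (separating v w) ≤
        c * (Real.pi⁻¹ * (ballMeasure E).real Set.univ) * dist (‖v‖⁻¹ • v) (‖w‖⁻¹ • w) := by
      refine hb.trans ?_
      rw [div_eq_mul_inv]
      calc _ = InnerProductGeometry.angle v w * (Real.pi⁻¹ * (ballMeasure E).real Set.univ) := by
            ring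
        _ ≤ (c * dist (‖v‖⁻¹ • v) (‖w‖⁻¹ • w)) *
            (Real.pi⁻¹ * (ballMeasure E).real Set.univ) := by gcongr
        _ = _ := by ring
    rw [edist_comm, edist_dist, ← ofReal_measureReal (μ := ballMeasure E) (s := Set.univ),
      ← ofReal_measureReal (μ := ballMeasure E) (s := separating v w),
      ← ENNReal.ofReal_mul (by positivity), ← ENNReal.ofReal_mul (by positivity),
      ← ENNReal.ofReal_mul (by positivity)]
    exact ENNReal.ofReal_le_ofReal hb'
  refine (Finset.sum_le_sum step).trans ?_
  rw [← Finset.mul_sum]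
  refine (mul_le_mul' le_rfl ?_).trans_eq (mul_assoc _ _ _)
  have hmono : MonotoneOn (fun j : ℕ => (j : ℝ) / (m + 1)) (Set.Icc 0 (m + 1)) := by
    intro a _ b _ hab
    have : (a : ℝ) ≤ b := by exact_mod_cast hab
    change (a : ℝ) / (m + 1) ≤ b / (m + 1)
    gcongr
  rw [Finset.range_eq_Ico]
  exact eVariationOn.sum_le_of_monotoneOn_Icc (f := fun t => ‖g t‖⁻¹ • g t) hmono
    fun i hi => hgrid i hi.2

/-- Averaged over all hyperplanes through the origin, a curve crosses a hyperplane at most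
`length / π` times, where the length is that of the projection to the unit sphere. -/
theorem lintegral_liminf_gridCount_le {g : ℝ → E} (hg : Continuous g) (hg0 : ∀ t, g t ≠ 0) :
    ∫⁻ u, liminf (fun m => (gridCount g m u : ENNReal)) atTop ∂(ballMeasure E)
      ≤ ENNReal.ofReal Real.pi⁻¹ * ballMeasure E Set.univ *
        eVariationOn (fun t => ‖g t‖⁻¹ • g t) (Set.Icc 0 1) := by
  set X := ENNReal.ofReal Real.pi⁻¹ * ballMeasure E Set.univ *
        eVariationOn (fun t => ‖g t‖⁻¹ • g t) (Set.Icc 0 1)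
  -- Fatou's lemma for each `c > 1`; then `c` tends to 1.
  have key : ∀ c : ℝ, 1 < c →
      ∫⁻ u, liminf (fun m => (gridCount g m u : ENNReal)) atTop ∂(ballMeasure E)
        ≤ ENNReal.ofReal c * X := fun c hc =>
    (lintegral_liminf_le fun m => measurable_gridCount g m).trans <|
      liminf_le_of_frequently_le' (eventually_lintegral_gridCount_le hg hg0 hc).frequently
  have hlim : Tendsto (fun c : ℝ => ENNReal.ofReal c * X) (𝓝[>] 1) (𝓝 (ENNReal.ofReal 1 * X)) :=
    ENNReal.Tendsto.mul_const
      ((ENNReal.continuous_ofReal.tendsto 1).mono_left nhdsWithin_le_nhds) (Or.inl (by simp))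
  rw [ENNReal.ofReal_one, one_mul] at hlim
  exact ge_of_tendsto hlim (eventually_mem_nhdsWithin.mono fun c hc => key c hc)

end Measure

end Grid

/-! ### Cut counts of generic hyperplanes -/

section CutCount

theorem exists_mem_Ico_coe_eq (x : UnitAddCircle) :
    ∃ t ∈ Set.Ico (0 : ℝ) 1, (t : UnitAddCircle) = x := by
  obtain ⟨t, ht, h⟩ := AddCircle.eq_coe_Ico (p := (1 : ℝ)) x
  exact ⟨t, ht, h⟩

/-- A connected subset of the circle that avoids the rational points has at most one element. -/
theorem subsingleton_of_isPreconnected_of_rat {C : Set UnitAddCircle} (hC : IsPreconnected C)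
    (hq : ∀ q : ℚ, ((q : ℝ) : UnitAddCircle) ∉ C) : C.Subsingleton := by
  have key : ∀ s t : ℝ, s ∈ Set.Ico (0 : ℝ) 1 → t ∈ Set.Ico (0 : ℝ) 1 → (s : UnitAddCircle) ∈ C →
      (t : UnitAddCircle) ∈ C → ¬ s < t := by
    intro s t hs ht hsC htC hst
    obtain ⟨q, hsq, hqt⟩ := exists_rat_btwn hst
    have hs0 : 0 < s := by
      refine lt_of_le_of_ne hs.1 fun h => hq 0 ?_
      rw [← h] at hsC
      simpa using hsC
    have hopen : ∀ a b : ℝ, IsOpen ((fun r : ℝ => (r : UnitAddCircle)) '' Set.Ioo a b) :=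
      fun a b => QuotientAddGroup.isOpenMap_coe _ isOpen_Ioo
    -- Removing 0 and `q` splits the circle into two disjoint open arcs, both of which would meet
    -- the connected set `C`.
    obtain ⟨x, _, ⟨a, ha, hax⟩, ⟨b, hb, hbx⟩⟩ := hC _ _ (hopen 0 q) (hopen q 1) (fun x hx => by
      obtain ⟨r, hr, rfl⟩ := exists_mem_Ico_coe_eq x
      have hr0 : 0 < r := by
        refine lt_of_le_of_ne hr.1 fun h => hq 0 ?_
        rw [← h] at hx
        simpa using hx
      rcases lt_trichotomy r q with h | h | h
      · exact Or.inl ⟨r, ⟨hr0, h⟩, rfl⟩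
      · exact absurd (h ▸ hx) (hq q)
      · exact Or.inr ⟨r, ⟨h, hr.2⟩, rfl⟩)
      ⟨s, hsC, s, ⟨hs0, hsq⟩, rfl⟩ ⟨t, htC, t, ⟨hqt, ht.2⟩, rfl⟩
    have hab : a = b := by
      refine (AddCircle.coe_eq_coe_iff_of_mem_Ico (p := (1 : ℝ)) (a := 0) ?_ ?_).mp
        (hax.trans hbx.symm)
      · exact ⟨ha.1.le, by linarith [ha.2, ht.2]⟩
      · exact ⟨by linarith [hb.1, hs0], by linarith [hb.2]⟩
    linarith [ha.2, hb.1]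
  intro x hx y hy
  obtain ⟨s, hs, rfl⟩ := exists_mem_Ico_coe_eq x
  obtain ⟨t, ht, rfl⟩ := exists_mem_Ico_coe_eq y
  rcases lt_trichotomy s t with h | h | h
  · exact absurd h (key s t hs ht hx hy)
  · rw [h]
  · exact absurd h (key t s ht hs hy hx)

namespace ClosedCurve

variable {d : ℕ}

theorem height_add_int (K : ClosedCurve d) (u : EuclideanSpace ℝ (Fin d)) (c t : ℝ) (k : ℤ) :
    K.height u c ((t + k : ℝ) : UnitAddCircle) = K.height u c (t : UnitAddCircle) := by
  have : ((k : ℝ) : UnitAddCircle) = 0 := (AddCircle.coe_eq_zero_iff 1).mpr ⟨k, zsmul_one k⟩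
  rw [AddCircle.coe_add, this, add_zero]

/-- Any real lift of any point of `C` may witness the arc. When `C` is one point the lifts differ by
integers, so all arcs can be moved to a common lift and compared. -/
theorem preceded_transfer (K : ClosedCurve d) (u : EuclideanSpace ℝ (Fin d)) (c : ℝ)
    {C : Set UnitAddCircle} (hC : C.Subsingleton) {P : ℝ → Prop} {t₀ : ℝ}
    (ht₀ : (t₀ : UnitAddCircle) ∈ C)
    (h : ∃ t : ℝ, (t : UnitAddCircle) ∈ C ∧
      ∃ ε > 0, ∀ s ∈ Set.Ioo (t - ε) t, P (K.height u c (s : UnitAddCircle))) :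
    ∃ ε > 0, ∀ s ∈ Set.Ioo (t₀ - ε) t₀, P (K.height u c (s : UnitAddCircle)) := by
  obtain ⟨t, htC, ε, hε, h⟩ := h
  obtain ⟨k, hk⟩ := (AddCircle.coe_eq_zero_iff 1).mp
    (by rw [AddCircle.coe_sub, hC htC ht₀, sub_self] : ((t - t₀ : ℝ) : UnitAddCircle) = 0)
  rw [zsmul_one] at hk
  refine ⟨ε, hε, fun s hs => ?_⟩
  rw [← K.height_add_int u c s k]
  exact h _ ⟨by linarith [hs.1], by linarith [hs.2]⟩

theorem followed_transfer (K : ClosedCurve d) (u : EuclideanSpace ℝ (Fin d)) (c : ℝ)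
    {C : Set UnitAddCircle} (hC : C.Subsingleton) {P : ℝ → Prop} {t₀ : ℝ}
    (ht₀ : (t₀ : UnitAddCircle) ∈ C)
    (h : ∃ t : ℝ, (t : UnitAddCircle) ∈ C ∧
      ∃ ε > 0, ∀ s ∈ Set.Ioo t (t + ε), P (K.height u c (s : UnitAddCircle))) :
    ∃ ε > 0, ∀ s ∈ Set.Ioo t₀ (t₀ + ε), P (K.height u c (s : UnitAddCircle)) := by
  obtain ⟨t, htC, ε, hε, h⟩ := h
  obtain ⟨k, hk⟩ := (AddCircle.coe_eq_zero_iff 1).mp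
    (by rw [AddCircle.coe_sub, hC htC ht₀, sub_self] : ((t - t₀ : ℝ) : UnitAddCircle) = 0)
  rw [zsmul_one] at hk
  refine ⟨ε, hε, fun s hs => ?_⟩
  rw [← K.height_add_int u c s k]
  exact h _ ⟨by linarith [hs.1], by linarith [hs.2]⟩

/-- For a generic hyperplane every intersection is a transverse crossing at a single point, so the
number of cuts is at most the number of points of intersection. -/
theorem cutCount_le_encard {K : ClosedCurve d} {p u : EuclideanSpace ℝ (Fin d)}
    (hu : IsGenericDirection (fun t : ℝ => K (t : UnitAddCircle) - p) u) :
    K.cutCount u ⟪u, p⟫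
      ≤ {t ∈ Set.Ioo (0 : ℝ) 1 | ⟪u, K (t : UnitAddCircle) - p⟫ = 0}.encard := by
  set S := {t ∈ Set.Ioo (0 : ℝ) 1 | ⟪u, K (t : UnitAddCircle) - p⟫ = 0}
  have hheight : ∀ x, K.height u ⟪u, p⟫ x = ⟪u, K x - p⟫ := fun x => by
    rw [inner_sub_right]; rfl
  have hrat : ∀ q : ℚ, ((q : ℝ) : UnitAddCircle) ∉ K.pullback u ⟪u, p⟫ := fun q hq =>
    hu.ne_zero q ((hheight _).symm.trans hq)
  have hcomp : ∀ C ∈ K.components u ⟪u, p⟫,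
      C.Subsingleton ∧ ∃ t ∈ S, (t : UnitAddCircle) ∈ C := by
    rintro C ⟨x, hx, rfl⟩
    refine ⟨subsingleton_of_isPreconnected_of_rat isPreconnected_connectedComponentIn
      fun q hq => hrat q (connectedComponentIn_subset _ _ hq), ?_⟩
    obtain ⟨t, ht, rfl⟩ := exists_mem_Ico_coe_eq x
    refine ⟨t, ⟨⟨lt_of_le_of_ne ht.1 fun h => ?_, ht.2⟩, (hheight _).symm.trans hx⟩,
      mem_connectedComponentIn hx⟩
    rw [← h] at hx
    exact hrat 0 (by simpa using hx)
  have hcard : (K.components u ⟪u, p⟫).encard ≤ S.encard := by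
    refine le_trans (Set.encard_le_encard fun C hC => ?_)
      (Set.encard_image_le (fun t : ℝ => ({(t : UnitAddCircle)} : Set UnitAddCircle)) S)
    obtain ⟨hs, t, ht, htC⟩ := hcomp C hC
    exact ⟨t, ht, (hs.eq_singleton_of_mem htC).symm⟩
  have hrats : ∀ t ε₁ ε₂ : ℝ, 0 < ε₁ → 0 < ε₂ → ∃ a b : ℚ,
      t ∈ Set.Icc (a : ℝ) b ∧ Set.Icc (a : ℝ) b ⊆ Set.Ioo (t - ε₁) (t + ε₂) := by
    intro t ε₁ ε₂ h₁ h₂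
    obtain ⟨a, ha1, ha2⟩ := exists_rat_btwn (sub_lt_self t h₁)
    obtain ⟨b, hb1, hb2⟩ := exists_rat_btwn (lt_add_of_pos_right t h₂)
    exact ⟨a, b, ⟨ha2.le, hb1.le⟩, Set.Icc_subset_Ioo ha1 hb2⟩
  -- Arcs of opposite sign on the same side of the point conflict. Arcs of equal sign on both sides
  -- make the zero a local extremum, which genericity forbids on a small rational interval.
  have hdisj : Disjoint (K.upward u ⟪u, p⟫) (K.downward u ⟪u, p⟫) := by
    refine Set.disjoint_left.mpr ?_
    rintro C ⟨hC, hup⟩ ⟨-, hdown⟩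
    obtain ⟨hs, t, ⟨-, h0⟩, htC⟩ := hcomp C hC
    rcases hup with hup | hup <;> rcases hdown with hdown | hdown
    · obtain ⟨ε₁, hε₁, h₁⟩ := K.preceded_transfer u _ hs (P := fun r => r < 0) htC hup
      obtain ⟨ε₂, hε₂, h₂⟩ := K.preceded_transfer u _ hs (P := fun r => 0 < r) htC hdown
      obtain ⟨s, hs1, hs2⟩ := exists_between (max_lt (sub_lt_self t hε₁) (sub_lt_self t hε₂))
      exact lt_asymm (h₁ s ⟨(le_max_left _ _).trans_lt hs1, hs2⟩)
        (h₂ s ⟨(le_max_right _ _).trans_lt hs1, hs2⟩)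
    · obtain ⟨ε₁, hε₁, h₁⟩ := K.preceded_transfer u _ hs (P := fun r => r < 0) htC hup
      obtain ⟨ε₂, hε₂, h₂⟩ := K.followed_transfer u _ hs (P := fun r => r < 0) htC hdown
      obtain ⟨a, b, htab, hab⟩ := hrats t ε₁ ε₂ hε₁ hε₂
      obtain ⟨s, hsab, hpos⟩ := hu.exists_pos a b t htab h0
      rw [← hheight] at hpos h0
      rcases lt_trichotomy s t with h | h | h
      · exact lt_asymm hpos (h₁ s ⟨(hab hsab).1, h⟩)
      · rw [h, h0] at hpos
        exact lt_irrefl _ hpos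
      · exact lt_asymm hpos (h₂ s ⟨h, (hab hsab).2⟩)
    · obtain ⟨ε₁, hε₁, h₁⟩ := K.preceded_transfer u _ hs (P := fun r => 0 < r) htC hdown
      obtain ⟨ε₂, hε₂, h₂⟩ := K.followed_transfer u _ hs (P := fun r => 0 < r) htC hup
      obtain ⟨a, b, htab, hab⟩ := hrats t ε₁ ε₂ hε₁ hε₂
      obtain ⟨s, hsab, hneg⟩ := hu.exists_neg a b t htab h0
      rw [← hheight] at hneg h0
      rcases lt_trichotomy s t with h | h | h
      · exact lt_asymm hneg (h₁ s ⟨(hab hsab).1, h⟩)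
      · rw [h, h0] at hneg
        exact lt_irrefl _ hneg
      · exact lt_asymm hneg (h₂ s ⟨h, (hab hsab).2⟩)
    · obtain ⟨ε₁, hε₁, h₁⟩ := K.followed_transfer u _ hs (P := fun r => 0 < r) htC hup
      obtain ⟨ε₂, hε₂, h₂⟩ := K.followed_transfer u _ hs (P := fun r => r < 0) htC hdown
      obtain ⟨s, hs1, hs2⟩ := exists_between
        (lt_min (lt_add_of_pos_right t hε₁) (lt_add_of_pos_right t hε₂))
      exact lt_asymm (h₁ s ⟨hs1, hs2.trans_le (min_le_left _ _)⟩)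
        (h₂ s ⟨hs1, hs2.trans_le (min_le_right _ _)⟩)
  rw [cutCount]
  split_ifs with hin hinf
  · exact absurd (hin ((0 : ℚ) : ℝ)) fun h => hrat 0 (sub_eq_zero.mpr h)
  · rwa [hinf.encard_eq] at hcard
  · rw [← Set.encard_union_eq hdisj]
    exact (Set.encard_le_encard (Set.union_subset (fun C hC => hC.1) fun C hC => hC.1)).trans hcard

theorem eVariationOn_radialProjection (K : ClosedCurve d) (p : EuclideanSpace ℝ (Fin d))
    (s : Set ℝ) :
    eVariationOn (fun t : ℝ => radialProjection p (K (t : UnitAddCircle))) s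
      = eVariationOn (fun t : ℝ => ‖K (t : UnitAddCircle) - p‖⁻¹ • (K (t : UnitAddCircle) - p))
        s := by
  simp only [eVariationOn, radialProjection, edist_add_left]

end ClosedCurve

end CutCount

/-! ### Averaging over all hyperplanes through the point -/

theorem mainTheorem6 {d : ℕ} {ι : Type*} [Fintype ι] [Nonempty ι] (K : ι → ClosedCurve d) (n : ℕ)
    (p : EuclideanSpace ℝ (Fin d)) (hpK : ∀ (i : ι) (x : UnitAddCircle), K i x ≠ p)
    (hp : p ∈ nthHull K n) :
    ENNReal.ofReal (2 * Real.pi * n) ≤ coneAngle K p := by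
  set g : ι → ℝ → EuclideanSpace ℝ (Fin d) := fun i t => K i (t : UnitAddCircle) - p
  have hg : ∀ i, Continuous (g i) := fun i =>
    ((K i).continuous.comp (AddCircle.continuous_mk' 1)).sub continuous_const
  have hg0 : ∀ i t, g i t ≠ 0 := fun i t => sub_ne_zero.mpr (hpK i _)
  set μ := ballMeasure (EuclideanSpace ℝ (Fin d))
  have hcuts : ∀ᵐ u ∂μ, ((2 * n : ℕ) : ENNReal)
      ≤ ∑ i, liminf (fun m => (gridCount (g i) m u : ENNReal)) atTop := by
    have hgen : ∀ᵐ u : EuclideanSpace ℝ (Fin d), ∀ i, IsGenericDirection (g i) u :=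
      ae_all_iff.mpr fun i => ae_isGenericDirection (hg0 i)
    filter_upwards [ballMeasure_absolutelyContinuous.ae_le hgen] with u hu
    -- The hull condition concerns nonzero normals only; genericity for a single curve, available
    -- because the link is nonempty, rules out zero.
    have hu0 : u ≠ 0 := by
      rintro rfl
      exact (hu (Classical.arbitrary ι)).ne_zero 0 (inner_zero_left _)
    have h1 : ((2 * n : ℕ) : ℕ∞) ≤ ∑ i, (K i).cutCount u ⟪u, p⟫ := hp u hu0
    have h2 := ENat.toENNReal_le.mpr h1
    rw [ENat.toENNReal_coe, ← ENat.toENNRealRingHom_apply, map_sum] at h2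
    refine h2.trans (Finset.sum_le_sum fun i _ => ?_)
    exact (ENat.toENNReal_le.mpr (ClosedCurve.cutCount_le_encard (hu i))).trans
      ((hu i).encard_zeros_le_liminf (hg i))
  have hint : ((2 * n : ℕ) : ENNReal) * μ Set.univ
      ≤ ENNReal.ofReal Real.pi⁻¹ * coneAngle K p * μ Set.univ := by
    calc ((2 * n : ℕ) : ENNReal) * μ Set.univ = ∫⁻ _, ((2 * n : ℕ) : ENNReal) ∂μ := by
          rw [lintegral_const]
      _ ≤ ∫⁻ u, ∑ i, liminf (fun m => (gridCount (g i) m u : ENNReal)) atTop ∂μ :=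
          lintegral_mono_ae hcuts
      _ = ∑ i, ∫⁻ u, liminf (fun m => (gridCount (g i) m u : ENNReal)) atTop ∂μ :=
          lintegral_finsetSum _ fun i _ => .liminf fun m => measurable_gridCount (g i) m
      _ ≤ ∑ i, ENNReal.ofReal Real.pi⁻¹ * μ Set.univ *
            eVariationOn (fun t => ‖g i t‖⁻¹ • g i t) (Set.Icc 0 1) :=
          Finset.sum_le_sum fun i _ => lintegral_liminf_gridCount_le (hg i) (hg0 i)
      _ = ENNReal.ofReal Real.pi⁻¹ * coneAngle K p * μ Set.univ := by
          simp only [coneAngle, ClosedCurve.eVariationOn_radialProjection]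
          rw [← Finset.mul_sum]
          ring
  have hle := (ENNReal.mul_le_mul_iff_left ballMeasure_univ_ne_zero (measure_ne_top _ _)).mp hint
  calc ENNReal.ofReal (2 * Real.pi * n)
      = ENNReal.ofReal Real.pi * ((2 * n : ℕ) : ENNReal) := by
        rw [← ENNReal.ofReal_natCast, ← ENNReal.ofReal_mul Real.pi_pos.le]
        push_cast
        ring_nf
    _ ≤ ENNReal.ofReal Real.pi * (ENNReal.ofReal Real.pi⁻¹ * coneAngle K p) := by gcongr
    _ = coneAngle K p := by
        rw [← mul_assoc, ← ENNReal.ofReal_mul Real.pi_pos.le, mul_inv_cancel₀ Real.pi_ne_zero,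
          ENNReal.ofReal_one, one_mul]
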